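/- Consider an optical wireless link with $N$ transmitter and $M\ge 1$ receiver apertures, $\mathbf y=\frac1{P_{op}}\mathbf H\mathbf x+\mathbf n$. The channel entries are independent and log-normal, $h_{ij}=e^{z_{ij}}$ with $z_{ij}\sim\mathcal N(\mu_{ij},\sigma_{ij}^2)$, $\sigma_{ij}>0$. The noise $\mathbf n$ is independent of $\mathbf H$ and white Gaussian with variance $\sigma_{\mathbf n}^2$ per dimension. The codeword of a symbol vector $\mathbf s=(s_1,\dots,s_L)$, whose entries are drawn independently and uniformly from a finite constellation, is $\mathbf x=\sum_{\ell=1}^L\mathbf F_\ell(s_\ell)\in\mathbb R^N$, and $P_{op}=E[\sum_n x_n]>0$ is the average optical power. Let $\mathcal E$ be the set of all differences of two distinct codewords, and assume that the entries of each $\mathbf e\in\mathcal E$ are all nonzero and of the same sign. Let $\mathbf s,\hat{\mathbf s}$ have distinct codewords, let $\mathbf e=(e_1,\dots,e_N)^T$ be the difference of the two codewords, and let $Q$ be the tail function of the standard normal law. For $\rho>0$ let $$P(\mathbf s\to\hat{\mathbf s})=E_{\mathbf H}\Big[Q\big(\tfrac{d(\mathbf e)}2\big)\Big],\qquad d^2(\mathbf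 e)=\frac{\rho}{NP_{op}^2}\sum_{i=1}^M\Big(\sum_{j=1}^N h_{ij}e_j\Big)^2 .$$ Put $\Omega=\sum_{i=1}^M\sum_{j=1}^N\sigma_{ij}^{-2}$, $$C_L=\frac{\prod_{i,j}\sigma_{ij}}{(4\pi)^{MN}\exp(-\frac{MN}2)}\,Q\Big(\tfrac12\big(\textstyle\sum_{k}e_k^2\big)^{-1/2}\Big),\qquad C_U=\frac{(NP_{op}^2)^{MN}}{2\prod_{i,j}\sqrt{\sigma_{ij}^2}}\exp\Big(-\frac\Omega8\ln^2\frac{NP_{op}^2\Omega}{M}\Big).$$ Then, for all sufficiently large $\rho$, $$C_L(\ln\rho)^{-MN}\exp\Big(-\sum_{i,j}\frac{\big(\ln\rho+\ln(P_{op}^2\Omega)-\ln(M\sum_k e_k^2)\big)^2}{8\sigma_{ij}^2}\Big)\le P(\mathbf s\to\hat{\mathbf s})$$ and $$P(\mathbf s\to\hat{\mathbf s})\le C_U(\ln\rho)^{-MN}\exp\Big(-\sum_{i,j}\frac{\big(\ln\frac{\rho}{\ln^2\rho}+\ln(P_{op}^2\Omega)-\ln e_j^2\big)^2}{8\sigma_{ij}^2}\Big)+\mathcal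 O\Big(\exp\Big(-\sum_{i,j}\frac{\ln^2\rho}{8\sigma_{ij}^2}\Big)\Big)\quad(\rho\to\infty).$$ Both bounds also hold, with the same constants, when $P(\mathbf s\to\hat{\mathbf s})$ is instead the probability, over $\mathbf H$ and $\mathbf n$ with $\rho=\frac1{N\sigma_{\mathbf n}^2}$, that a maximum-likelihood receiver which knows $\mathbf H$ finds $\hat{\mathbf s}$ at least as likely as the transmitted $\mathbf s$. -/

import Mathlib

open MeasureTheory ProbabilityTheory Filter Asymptotics
open scoped NNReal

namespace MimoOwc

/-- The Gaussian tail function `Q(x)`: the probability that a standard normal exceeds `x`. -/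
noncomputable def gaussianQ (x : ℝ) : ℝ := (gaussianReal 0 1).real (Set.Ioi x)

/-- The log-normal law of `h = exp z`, where `z` is normal with mean `m` and variance `s ^ 2`. -/
noncomputable def logNormal (m s : ℝ) : Measure ℝ :=
  (gaussianReal m (s ^ 2).toNNReal).map Real.exp

/-- The law of the `M × N` channel matrix `H` with independent log-normal entries `h i j`. -/
noncomputable def channelLaw {M N : ℕ} (μ σ : Fin M → Fin N → ℝ) :
    Measure (Fin M → Fin N → ℝ) :=
  Measure.pi fun i => Measure.pi fun j => logNormal (μ i j) (σ i j)

/-- The symbol vectors `s = (s_1, …, s_L)` with all entries in the constellation `B`. -/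
def symbolVectors (L : ℕ) (B : Finset ℝ) : Finset (Fin L → ℝ) :=
  Fintype.piFinset fun _ => B

/-- The space codeword `x = ∑ ℓ, F_ℓ (s_ℓ)`. -/
def codeword {L N : ℕ} (F : Fin L → ℝ → Fin N → ℝ) (s : Fin L → ℝ) : Fin N → ℝ :=
  fun n => ∑ ℓ, F ℓ (s ℓ) n

/-- The average optical power `E[∑ n, x_n]`; all symbol vectors are equally likely. -/
noncomputable def averagePower {L N : ℕ} (B : Finset ℝ) (F : Fin L → ℝ → Fin N → ℝ) : ℝ :=
  (∑ s ∈ symbolVectors L B, ∑ n, codeword F s n) / ((symbolVectors L B).card : ℝ)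

/-- The set of error vectors: differences of distinct codewords. -/
def errorSet {L N : ℕ} (B : Finset ℝ) (F : Fin L → ℝ → Fin N → ℝ) : Set (Fin N → ℝ) :=
  {e | ∃ s ∈ symbolVectors L B, ∃ s' ∈ symbolVectors L B,
    codeword F s ≠ codeword F s' ∧ e = codeword F s - codeword F s'}

/-- A real vector is unipolar if it does not have entries of opposite signs. -/
def IsUnipolar {N : ℕ} (e : Fin N → ℝ) : Prop := (∀ j, 0 ≤ e j) ∨ (∀ j, e j ≤ 0)

/-- The distance `d(e)` seen through the channel realization `H`, i.e. the nonnegative root of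
`d(e)² = ρ / (N Pop²) * ∑ i, (h_iᵀ e)²`. -/
noncomputable def distance {M N : ℕ} (Pop ρ : ℝ) (e : Fin N → ℝ) (H : Fin M → Fin N → ℝ) : ℝ :=
  √(ρ / (N * Pop ^ 2) * ∑ i, (∑ j, H i j * e j) ^ 2)

/-- The pairwise error probability `Q(d(e)/2)`, averaged over the channel. -/
noncomputable def pep {M N : ℕ} (μ σ : Fin M → Fin N → ℝ) (Pop : ℝ) (e : Fin N → ℝ) (ρ : ℝ) :
    ℝ :=
  ∫ H, gaussianQ (distance Pop ρ e H / 2) ∂(channelLaw μ σ)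

/-- The received vector `y = (1 / Pop) H x + n`. -/
noncomputable def received {M N : ℕ} (Pop : ℝ) (H : Fin M → Fin N → ℝ) (x : Fin N → ℝ)
    (n : Fin M → ℝ) : Fin M → ℝ :=
  fun i => 1 / Pop * (∑ j, H i j * x j) + n i

/-- The likelihood of the codeword `x` given the received vector `y` and the channel `H`, for white
Gaussian noise of variance `v` per dimension. -/
noncomputable def likelihood {M N : ℕ} (Pop : ℝ) (v : ℝ≥0) (H : Fin M → Fin N → ℝ)
    (y : Fin M → ℝ) (x : Fin N → ℝ) : ℝ :=
  ∏ i, gaussianPDFReal (1 / Pop * ∑ j, H i j * x j) v (y i)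

/-- The probability, over the channel and independent white Gaussian noise of variance `v` per
dimension, that `x` is sent and `x'` is at least as likely as `x` at the receiver, which knows the
channel. -/
noncomputable def mlPairwiseError {M N : ℕ} (μ σ : Fin M → Fin N → ℝ) (Pop : ℝ)
    (x x' : Fin N → ℝ) (v : ℝ≥0) : ℝ :=
  ((channelLaw μ σ).prod (Measure.pi fun _ : Fin M => gaussianReal 0 v)).real
    {w | likelihood Pop v w.1 (received Pop w.1 x w.2) x ≤
         likelihood Pop v w.1 (received Pop w.1 x w.2) x'}

/-- `Ω = ∑ i, ∑ j, σ i j ^ (-2)`. -/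
noncomputable def bigOmega {M N : ℕ} (σ : Fin M → Fin N → ℝ) : ℝ :=
  ∑ i, ∑ j, (σ i j ^ 2)⁻¹

/-- The constant `C_L`. -/
noncomputable def constL {M N : ℕ} (σ : Fin M → Fin N → ℝ) (e : Fin N → ℝ) : ℝ :=
  (∏ i, ∏ j, σ i j) / ((4 * Real.pi) ^ (M * N) * Real.exp (-((M : ℝ) * N / 2))) *
    gaussianQ (1 / 2 * (√(∑ k, e k ^ 2))⁻¹)

/-- The constant `C_U`. -/
noncomputable def constU {M N : ℕ} (σ : Fin M → Fin N → ℝ) (Pop : ℝ) : ℝ :=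
  (N * Pop ^ 2) ^ (M * N) / (2 * ∏ i, ∏ j, √(σ i j ^ 2)) *
    Real.exp (-(bigOmega σ / 8 * Real.log (N * Pop ^ 2 * bigOmega σ / M) ^ 2))

/-- The lower bound `P_L`. -/
noncomputable def lowerBound {M N : ℕ} (σ : Fin M → Fin N → ℝ) (Pop : ℝ) (e : Fin N → ℝ)
    (ρ : ℝ) : ℝ :=
  constL σ e * (Real.log ρ ^ (M * N))⁻¹ *
    Real.exp (-∑ i, ∑ j,
      (Real.log ρ + Real.log (Pop ^ 2 * bigOmega σ) - Real.log (M * ∑ k, e k ^ 2)) ^ 2 /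
        (8 * σ i j ^ 2))

/-- The main term `P_U` of the upper bound. -/
noncomputable def upperBound {M N : ℕ} (σ : Fin M → Fin N → ℝ) (Pop : ℝ) (e : Fin N → ℝ)
    (ρ : ℝ) : ℝ :=
  constU σ Pop * (Real.log ρ ^ (M * N))⁻¹ *
    Real.exp (-∑ i, ∑ j,
      (Real.log (ρ / Real.log ρ ^ 2) + Real.log (Pop ^ 2 * bigOmega σ) - Real.log (e j ^ 2)) ^ 2 /
        (8 * σ i j ^ 2))

/-- The size of the remainder of the upper bound. -/
noncomputable def remainder {M N : ℕ} (σ : Fin M → Fin N → ℝ) (ρ : ℝ) : ℝ :=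
  Real.exp (-∑ i, ∑ j, Real.log ρ ^ 2 / (8 * σ i j ^ 2))

/-- `A ρ ≤ P ρ ≤ B ρ + O(R ρ)` for all sufficiently large `ρ`. -/
def AsymptoticallyBounded (A P B R : ℝ → ℝ) : Prop :=
  (∀ᶠ ρ in atTop, A ρ ≤ P ρ) ∧
    ∃ r : ℝ → ℝ, r =O[atTop] R ∧ ∀ᶠ ρ in atTop, P ρ ≤ B ρ + r ρ

end MimoOwc

namespace MimoOwc

/-! Write ℓ = log ρ. Both claimed bounds are loose at the order ℓ log ℓ in the exponent, and this
slack absorbs all linear terms in ℓ, hence every constant: the means `μ`, `constL`, `constU`, the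
powers of ℓ and the scaling of the noise. Upper bound: for a unipolar error vector and positive
gains, cross terms only help, so (∑ h_j e_j)² ≥ ∑ h_j² e_j². With a Chernoff bound the error
probability is at most a product of Laplace transforms of squared log-normals (`pep_le_integral`,
`mlPairwiseError_le_integral`). Each factor is at most exp(-(ℓ² - 2ℓ log ℓ + O(ℓ)) / (8σ²)), while
the claimed factor has -4ℓ log ℓ in place of -2ℓ log ℓ. No remainder is needed. Lower bound: let all
gains fade below √(ℓ/ρ). This has probability at least a product of terms exp(-(ℓ - log ℓ + O(1))² /
(8σ²)), larger than the claimed exp(-(ℓ + O(1))² / (8σ²)) by a factor of order exp(2ℓ log ℓ /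
(8σ²)). On that event the distance is O(√ℓ), so the Gaussian tail costs only exp(-O(ℓ))
(`mul_channelLaw_le_pep`, `mul_channelLaw_le_mlPairwiseError`). -/

/-! ### Gaussian tails -/

lemma gaussianQ_antitone : Antitone gaussianQ := fun _ _ h =>
  measureReal_mono (Set.Ioi_subset_Ioi h)

lemma gaussianQ_nonneg (x : ℝ) : 0 ≤ gaussianQ x := measureReal_nonneg

lemma gaussianQ_le_one (x : ℝ) : gaussianQ x ≤ 1 := measureReal_le_one

/-- The Chernoff bound for the Gaussian tail. -/
lemma gaussianQ_le_exp {x : ℝ} (hx : 0 ≤ x) : gaussianQ x ≤ Real.exp (-(x ^ 2 / 2)) := by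
  have h := measure_ge_le_exp_mul_mgf (μ := gaussianReal 0 1) (X := id) x hx
    (by simpa using integrable_exp_mul_gaussianReal (μ := 0) (v := 1) x)
  rw [mgf_id_gaussianReal, ← Real.exp_add] at h
  have h1 : gaussianQ x ≤ (gaussianReal 0 1).real {ω | x ≤ id ω} :=
    measureReal_mono fun y (hy : x < y) => hy.le
  refine h1.trans (h.trans_eq ?_)
  congr 1
  push_cast
  ring

/-- A crude lower bound for the Gaussian tail, by the density at the end of a unit interval. -/
lemma gaussianQ_ge {x : ℝ} (hx : 0 ≤ x) :
    (√(2 * Real.pi))⁻¹ * Real.exp (-((x + 1) ^ 2 / 2)) ≤ gaussianQ x := by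
  have h1 : (gaussianReal 0 1).real (Set.Ioc x (x + 1)) ≤ gaussianQ x :=
    measureReal_mono fun y hy => hy.1
  refine le_trans ?_ h1
  rw [measureReal_def, gaussianReal_apply_eq_integral 0 one_ne_zero,
    ENNReal.toReal_ofReal (integral_nonneg fun y => gaussianPDFReal_nonneg _ _ _)]
  have h2 := setIntegral_ge_of_const_le_real (μ := volume) (s := Set.Ioc x (x + 1))
    (f := gaussianPDFReal 0 1) (c := (√(2 * Real.pi))⁻¹ * Real.exp (-((x + 1) ^ 2 / 2)))
    measurableSet_Ioc (by simp) (fun y hy => ?_) (integrable_gaussianPDFReal 0 1).integrableOn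
  · simpa using h2
  · simp only [gaussianPDFReal, NNReal.coe_one, mul_one, sub_zero]
    have : y ^ 2 ≤ (x + 1) ^ 2 := pow_le_pow_left₀ (hx.trans hy.1.le) hy.2 2
    gcongr
    rw [neg_div]
    gcongr

/-- A one-sided tail of a normal law, on the side selected by the sign `ε`. -/
lemma gaussianQ_le_gaussianReal {m s ε b : ℝ} (hs : 0 < s) (hε : ε ^ 2 = 1) :
    gaussianQ (b / s) ≤ (gaussianReal m (s ^ 2).toNNReal).real {x | ε * (x - m) ≤ -b} := by
  have hmap : gaussianReal m (s ^ 2).toNNReal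
      = (gaussianReal 0 1).map (fun x => (-(ε * s)) * x + m) := by
    rw [← Function.comp_def (fun x => x + m) (fun x => (-(ε * s)) * x),
      ← Measure.map_map (by fun_prop) (by fun_prop), gaussianReal_map_const_mul,
      gaussianReal_map_add_const]
    congr 1
    · simp
    · ext
      simp [mul_pow, hε, sq_nonneg]
  have hmeas : MeasurableSet {x : ℝ | ε * (x - m) ≤ -b} :=
    measurableSet_le (by fun_prop) measurable_const
  rw [hmap, map_measureReal_apply (by fun_prop) hmeas]
  refine measureReal_mono fun x (hx : b / s < x) => ?_
  rw [div_lt_iff₀ hs] at hx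
  have : ε * (-(ε * s) * x + m - m) = -(x * s) := by linear_combination (-(s * x)) * hε
  simp only [Set.mem_preimage, Set.mem_ofPred_eq, this]
  linarith

/-! ### The log-normal channel law -/

instance (m s : ℝ) : IsProbabilityMeasure (logNormal m s) :=
  Measure.isProbabilityMeasure_map (by fun_prop)

instance {M N : ℕ} (μ σ : Fin M → Fin N → ℝ) : IsProbabilityMeasure (channelLaw μ σ) := by
  unfold channelLaw
  infer_instance

lemma gaussianQ_le_logNormal_Ioc {m s t : ℝ} (hs : 0 < s) (ht : 0 < t) :
    gaussianQ ((m - Real.log t) / s) ≤ (logNormal m s).real (Set.Ioc 0 t) := by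
  rw [logNormal, map_measureReal_apply (by fun_prop) measurableSet_Ioc]
  refine (gaussianQ_le_gaussianReal (m := m) (ε := 1) hs (by simp)).trans
    (measureReal_mono fun x hx => ?_)
  have : x ≤ Real.log t := by
    have : 1 * (x - m) ≤ -(m - Real.log t) := hx
    linarith
  exact ⟨Real.exp_pos _, (Real.le_log_iff_exp_le ht).1 this⟩

lemma ae_logNormal_pos (m s : ℝ) : ∀ᵐ h ∂logNormal m s, 0 < h := by
  rw [logNormal, ae_map_iff (by fun_prop) measurableSet_Ioi]
  exact Eventually.of_forall fun x => Real.exp_pos x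

lemma ae_channelLaw_pos {M N : ℕ} (μ σ : Fin M → Fin N → ℝ) :
    ∀ᵐ H ∂channelLaw μ σ, ∀ i j, 0 < H i j := by
  rw [ae_all_iff]
  intro i
  have h1 : ∀ᵐ h ∂Measure.pi fun j => logNormal (μ i j) (σ i j), ∀ j, 0 < h j := by
    rw [ae_all_iff]
    intro j
    exact Measure.tendsto_eval_ae_ae.eventually (ae_logNormal_pos _ _)
  exact (Measure.tendsto_eval_ae_ae (μ := fun i => Measure.pi fun j =>
    logNormal (μ i j) (σ i j))).eventually h1

/-- The Laplace transform of the square of a log-normal variable is at most any of the bounds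
obtained from `exp (-x) ≤ (a / (exp 1 * x)) ^ a`. -/
lemma integral_logNormal_exp_le (m s : ℝ) {κ a : ℝ} (hκ : 0 < κ) (ha : 0 < a) :
    ∫ h, Real.exp (-(κ * h ^ 2)) ∂logNormal m s ≤
      Real.exp (a * Real.log (a / κ) - a - 2 * a * m + 2 * a ^ 2 * s ^ 2) := by
  rw [logNormal, integral_map (by fun_prop) (by fun_prop)]
  have key (z : ℝ) : Real.exp (-(κ * Real.exp z ^ 2)) ≤
      Real.exp (a * Real.log (a / κ) - a) * Real.exp (-2 * a * z) := by
    rw [← Real.exp_add, Real.exp_le_exp]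
    have h1 := Real.add_one_le_exp (2 * z - Real.log (a / κ))
    rw [Real.exp_sub, Real.exp_log (by positivity), two_mul z, Real.exp_add] at h1
    have h2 := mul_le_mul_of_nonneg_left h1 ha.le
    have h3 : a * (Real.exp z * Real.exp z / (a / κ)) = κ * Real.exp z ^ 2 := by
      field_simp
    rw [h3] at h2
    linarith
  -- What remains is the negative moment of order `2 * a` of the log-normal variable, a value of the
  -- Gaussian moment generating function.
  have hint := integrable_exp_mul_gaussianReal (μ := m) (v := (s ^ 2).toNNReal) (-2 * a)
  refine (integral_mono_of_nonneg (Eventually.of_forall fun z => (Real.exp_pos _).le)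
    (hint.const_mul _) (Eventually.of_forall key)).trans_eq ?_
  rw [integral_const_mul]
  have h4 : ∫ z, Real.exp (-2 * a * z) ∂gaussianReal m (s ^ 2).toNNReal
      = mgf id (gaussianReal m (s ^ 2).toNNReal) (-2 * a) := rfl
  rw [h4, mgf_id_gaussianReal, ← Real.exp_add, Real.coe_toNNReal _ (sq_nonneg s)]
  congr 1
  ring

lemma integral_channelLaw_exp {M N : ℕ} (μ σ : Fin M → Fin N → ℝ) (κ : Fin N → ℝ) :
    ∫ H, Real.exp (-∑ i, ∑ j, κ j * H i j ^ 2) ∂channelLaw μ σ =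
      ∏ i, ∏ j, ∫ h, Real.exp (-(κ j * h ^ 2)) ∂logNormal (μ i j) (σ i j) := by
  simp_rw [← Finset.sum_neg_distrib, Real.exp_sum, channelLaw]
  rw [integral_fintype_prod_eq_prod (f := fun i (x : Fin N → ℝ) =>
    ∏ j, Real.exp (-(κ j * x j ^ 2)))]
  refine Finset.prod_congr rfl fun i _ => ?_
  rw [integral_fintype_prod_eq_prod (f := fun j (x : ℝ) => Real.exp (-(κ j * x ^ 2)))]

/-- The set of channel matrices with all entries in `(0, t]`. -/
def channelBox (M N : ℕ) (t : ℝ) : Set (Fin M → Fin N → ℝ) :=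
  Set.pi Set.univ fun _ => Set.pi Set.univ fun _ => Set.Ioc 0 t

lemma measurableSet_channelBox (M N : ℕ) (t : ℝ) : MeasurableSet (channelBox M N t) :=
  MeasurableSet.univ_pi fun _ => MeasurableSet.univ_pi fun _ => measurableSet_Ioc

lemma prod_gaussianQ_le_channelLaw {M N : ℕ} (μ : Fin M → Fin N → ℝ) {σ : Fin M → Fin N → ℝ}
    (hσ : ∀ i j, 0 < σ i j) {t : ℝ} (ht : 0 < t) :
    ∏ i, ∏ j, gaussianQ ((μ i j - Real.log t) / σ i j) ≤
      (channelLaw μ σ).real (channelBox M N t) := by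
  have : (channelLaw μ σ).real (channelBox M N t) =
      ∏ i, ∏ j, (logNormal (μ i j) (σ i j)).real (Set.Ioc 0 t) := by
    simp only [measureReal_def, channelLaw, channelBox, Measure.pi_pi, ENNReal.toReal_prod]
  rw [this]
  exact Finset.prod_le_prod (fun i _ => Finset.prod_nonneg fun j _ => gaussianQ_nonneg _)
    fun i _ => Finset.prod_le_prod (fun j _ => gaussianQ_nonneg _)
    fun j _ => gaussianQ_le_logNormal_Ioc (hσ i j) ht

/-! ### Growth comparisons in ℓ = log ρ -/

/-- Linear, logarithmic and squared logarithmic terms are dominated by `x * log x`. -/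
lemma eventually_le_mul_log (A B C D : ℝ) :
    ∀ᶠ x : ℝ in atTop, A * x + B * Real.log x + C * Real.log x ^ 2 + D ≤ x * Real.log x := by
  have h1 := (Real.isLittleO_pow_log_id_atTop (n := 2)).def (c := 1) one_pos
  have h2 := Real.tendsto_log_atTop.eventually_ge_atTop (|A| + |B| + |C| + |D| + 1)
  filter_upwards [h1, h2, eventually_ge_atTop 1] with x h1 h2 h3
  have h0 : 0 ≤ Real.log x := Real.log_nonneg h3
  have h4 : Real.log x ^ 2 ≤ x := by
    simpa [abs_of_nonneg (zero_le_one.trans h3)] using h1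
  have h5 : Real.log x ≤ x := Real.log_le_self (by linarith)
  have a1 : A * x ≤ |A| * x := by gcongr; exact le_abs_self A
  have a2 : B * Real.log x ≤ |B| * x := by gcongr; exact le_abs_self B
  have a3 : C * Real.log x ^ 2 ≤ |C| * x := by gcongr; exact le_abs_self C
  have a4 : D ≤ |D| * x := by
    have := le_abs_self D
    nlinarith [abs_nonneg D]
  have a5 : x * (|A| + |B| + |C| + |D| + 1) ≤ x * Real.log x := by gcongr
  linarith

/-- The cross term -2x log x on the left beats any linear term. It is there because the fade level
is √(ℓ/ρ) and not 1/√ρ. -/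
lemma eventually_sq_gap_lower (A B C : ℝ) : ∀ᶠ x : ℝ in atTop,
    (x - Real.log x + B) ^ 2 + C * x ≤ (x + A) ^ 2 := by
  filter_upwards [eventually_le_mul_log (C + 2 * B - 2 * A) (-2 * B) 1 (B ^ 2 - A ^ 2),
    Real.tendsto_log_atTop.eventually_ge_atTop 0, eventually_ge_atTop 0] with x h h1 h2
  nlinarith [mul_nonneg h1 h2]

/-- The left square contains -4x log x, twice the term on the right; the difference 2x log x pays
for everything linear. -/
lemma eventually_sq_gap_upper (A B C : ℝ) : ∀ᶠ x : ℝ in atTop,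
    (x - 2 * Real.log x + A) ^ 2 + C * x ≤ x ^ 2 - 2 * x * Real.log x + B * x := by
  filter_upwards [eventually_le_mul_log (C + 2 * A - B) (-4 * A) 4 (A ^ 2),
    Real.tendsto_log_atTop.eventually_ge_atTop 0, eventually_ge_atTop 0] with x h h1 h2
  nlinarith [mul_nonneg h1 h2]

lemma eventually_mul_pow_le_exp {c : ℝ} (n : ℕ) (hc : 0 < c) :
    ∀ᶠ x : ℝ in atTop, 1 ≤ c * (x ^ n)⁻¹ * Real.exp x := by
  filter_upwards [(Real.tendsto_exp_div_pow_atTop n).eventually_ge_atTop c⁻¹] with x h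
  have := mul_le_mul_of_nonneg_left h hc.le
  rw [mul_inv_cancel₀ hc.ne'] at this
  refine this.trans_eq ?_
  ring

lemma log_div_log_sq {ρ : ℝ} (h : 0 < Real.log ρ) (hρ : 0 < ρ) :
    Real.log (ρ / Real.log ρ ^ 2) = Real.log ρ - 2 * Real.log (Real.log ρ) := by
  rw [Real.log_div hρ.ne' (by positivity), Real.log_pow]
  push_cast
  ring

/-! ### Comparison with the two claimed bounds -/

lemma constU_pos {M N : ℕ} {σ : Fin M → Fin N → ℝ} (hσ : ∀ i j, 0 < σ i j) {Pop : ℝ}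
    (hPop : 0 < Pop) (hN : 0 < N) : 0 < constU σ Pop := by
  have h : 0 < ∏ i, ∏ j, √(σ i j ^ 2) :=
    Finset.prod_pos fun i _ => Finset.prod_pos fun j _ => by have := hσ i j; positivity
  unfold constU
  positivity

/-- The product of the exponential moments of the squared channel gains is eventually below the
main term of the upper bound. -/
lemma eventually_integral_le_upperBound {M N : ℕ} (hM : 0 < M) (hN : 0 < N)
    (μ : Fin M → Fin N → ℝ) {σ : Fin M → Fin N → ℝ} (hσ : ∀ i j, 0 < σ i j) {Pop : ℝ}
    (hPop : 0 < Pop) {e : Fin N → ℝ} (he : ∀ j, e j ≠ 0) {k : ℝ} (hk : 0 < k) :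
    ∀ᶠ ρ in atTop, ∫ H, Real.exp (-∑ i, ∑ j, k * ρ * e j ^ 2 * H i j ^ 2) ∂channelLaw μ σ ≤
      upperBound σ Pop e ρ := by
  have hmain : ∀ᶠ ℓ : ℝ in atTop, ∀ i j,
      (ℓ - 2 * Real.log ℓ + (Real.log (Pop ^ 2 * bigOmega σ) - Real.log (e j ^ 2))) ^ 2
        + 8 * σ i j ^ 2 * ℓ ≤ ℓ ^ 2 - 2 * ℓ * Real.log ℓ +
          2 * (Real.log (4 * σ i j ^ 2 * (k * e j ^ 2)) + 1 + 2 * μ i j) * ℓ :=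
    eventually_all.2 fun i => eventually_all.2 fun j => eventually_sq_gap_upper _ _ _
  have hU := constU_pos hσ hPop hN
  filter_upwards [Real.tendsto_log_atTop.eventually hmain,
    Real.tendsto_log_atTop.eventually (eventually_mul_pow_le_exp (M * N) hU),
    Real.tendsto_log_atTop.eventually_gt_atTop 0, eventually_gt_atTop 0] with ρ h1 h2 hℓ hρ
  rw [integral_channelLaw_exp μ σ (fun j => k * ρ * e j ^ 2)]
  set ℓ := Real.log ρ with hℓdef
  have hterm (i j) : ∫ h, Real.exp (-(k * ρ * e j ^ 2 * h ^ 2)) ∂logNormal (μ i j) (σ i j) ≤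
      Real.exp (-((ℓ - 2 * Real.log ℓ + Real.log (Pop ^ 2 * bigOmega σ) - Real.log (e j ^ 2)) ^ 2
        / (8 * σ i j ^ 2)) - ℓ) := by
    have hs := hσ i j
    have hej := he j
    have hκ : 0 < k * ρ * e j ^ 2 := by positivity
    -- This `a` minimizes -aℓ + 2a²σ², the dominant part of the exponent, with minimum -ℓ²/(8σ²).
    refine (integral_logNormal_exp_le (μ i j) (σ i j) hκ
      (a := ℓ / (4 * σ i j ^ 2)) (by positivity)).trans (Real.exp_le_exp.2 ?_)
    have hlog : Real.log (ℓ / (4 * σ i j ^ 2) / (k * ρ * e j ^ 2)) =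
        Real.log ℓ - Real.log (4 * σ i j ^ 2 * (k * e j ^ 2)) - ℓ := by
      rw [div_div, show 4 * σ i j ^ 2 * (k * ρ * e j ^ 2)
        = 4 * σ i j ^ 2 * (k * e j ^ 2) * ρ by ring, Real.log_div hℓ.ne' (by positivity),
        Real.log_mul (by positivity) hρ.ne']
      ring
    rw [hlog]
    have h3 := h1 i j
    rw [← add_sub_assoc] at h3
    generalize Real.log (4 * σ i j ^ 2 * (k * e j ^ 2)) = c at *
    have h4 := div_le_div_of_nonneg_right h3 (c := 8 * σ i j ^ 2) (by positivity)
    rw [add_div, mul_div_cancel_left₀ _ (by positivity)] at h4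
    have h5 : ℓ / (4 * σ i j ^ 2) * (Real.log ℓ - c - ℓ) - ℓ / (4 * σ i j ^ 2)
        - 2 * (ℓ / (4 * σ i j ^ 2)) * μ i j + 2 * (ℓ / (4 * σ i j ^ 2)) ^ 2 * σ i j ^ 2
        = -((ℓ ^ 2 - 2 * ℓ * Real.log ℓ + 2 * (c + 1 + 2 * μ i j) * ℓ) / (8 * σ i j ^ 2)) := by
      field_simp
      ring
    rw [h5]
    linarith
  refine (Finset.prod_le_prod (fun i _ => Finset.prod_nonneg fun j _ => ?_) fun i _ =>
    Finset.prod_le_prod (fun j _ => ?_) fun j _ => hterm i j).trans ?_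
  · exact integral_nonneg fun h => (Real.exp_pos _).le
  · exact integral_nonneg fun h => (Real.exp_pos _).le
  simp_rw [← Real.exp_sum, upperBound, log_div_log_sq hℓ hρ, ← hℓdef]
  set S := ∑ i, ∑ j, (ℓ - 2 * Real.log ℓ + Real.log (Pop ^ 2 * bigOmega σ)
    - Real.log (e j ^ 2)) ^ 2 / (8 * σ i j ^ 2)
  have hsum : ∑ i, ∑ j, (-((ℓ - 2 * Real.log ℓ + Real.log (Pop ^ 2 * bigOmega σ)
      - Real.log (e j ^ 2)) ^ 2 / (8 * σ i j ^ 2)) - ℓ) = -S - (M * N : ℝ) * ℓ := by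
    simp [S, Finset.sum_sub_distrib, mul_assoc]
  rw [hsum]
  have hMN : (1 : ℝ) ≤ M * N := by exact_mod_cast Nat.mul_pos hM hN
  -- Each entry supplied a spare factor exp(-ℓ); one of them suffices to beat `constU` and the power
  -- of ℓ.
  have h6 : Real.exp (-S - (M * N : ℝ) * ℓ) ≤ Real.exp (-S) * Real.exp (-ℓ) := by
    rw [← Real.exp_add, Real.exp_le_exp]
    nlinarith
  refine h6.trans ?_
  have h7 := mul_le_mul_of_nonneg_right h2 (Real.exp_pos (-ℓ)).le
  rw [mul_assoc _ (Real.exp ℓ), ← Real.exp_add, add_neg_cancel, Real.exp_zero, mul_one,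
    one_mul] at h7
  rw [mul_comm]
  exact mul_le_mul_of_nonneg_right h7 (Real.exp_pos _).le

/-- The lower bound is eventually below the probability of a joint deep fade of all channel gains,
times any fixed power of a Gaussian tail at the scale of the square root of the logarithm. -/
lemma eventually_lowerBound_le_prod {M N : ℕ} (hM : 0 < M) (hN : 0 < N)
    (μ : Fin M → Fin N → ℝ) {σ : Fin M → Fin N → ℝ} (hσ : ∀ i j, 0 < σ i j) (Pop : ℝ)
    (e : Fin N → ℝ) {K : ℝ} (hK : 0 ≤ K) (m : ℕ) :
    ∀ᶠ ρ in atTop, lowerBound σ Pop e ρ ≤ gaussianQ (K * √(Real.log ρ)) ^ m *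
      ∏ i, ∏ j, gaussianQ ((μ i j - Real.log √(Real.log ρ / ρ)) / σ i j) := by
  set A := Real.log (Pop ^ 2 * bigOmega σ) - Real.log (M * ∑ k, e k ^ 2)
  set c := (√(2 * Real.pi))⁻¹
  have hc : 0 < c := by positivity
  -- `m * (K ^ 2 + 1)` pays for the `m` Gaussian tails, and the final 1 leaves a factor exp ℓ that
  -- overcomes `constL`.
  set C : ℝ := m * (K ^ 2 + 1) + 1 with hC
  have hC0 : 0 < C := by positivity
  have hmain : ∀ᶠ ℓ : ℝ in atTop, ∀ i j,
      (ℓ - Real.log ℓ + (2 * μ i j + 2 * σ i j)) ^ 2 + 8 * σ i j ^ 2 * C * ℓ ≤ (ℓ + A) ^ 2 :=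
    eventually_all.2 fun i => eventually_all.2 fun j => eventually_sq_gap_lower _ _ _
  -- This makes the argument of `gaussianQ` nonnegative, as `gaussianQ_ge` requires.
  have hlarge : ∀ᶠ ℓ : ℝ in atTop, ∀ i j, -(2 * μ i j) ≤ ℓ - Real.log ℓ := by
    refine eventually_all.2 fun i => eventually_all.2 fun j => ?_
    filter_upwards [Real.isLittleO_log_id_atTop.def (c := 1 / 2) (by norm_num),
      eventually_ge_atTop (4 * |μ i j|)] with x h1 h2
    have hx : 0 ≤ x := le_trans (by positivity) h2
    have h3 : Real.log x ≤ 1 / 2 * x := by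
      refine (le_abs_self _).trans ?_
      simpa [abs_of_nonneg hx] using h1
    have := neg_abs_le (μ i j)
    linarith
  have hexp : ∀ᶠ ℓ : ℝ in atTop, constL σ e ≤ c ^ m * c ^ (M * N) * Real.exp (ℓ - m) := by
    have h := (Real.tendsto_exp_atTop.comp (tendsto_atTop_add_const_right _ (-(m : ℝ))
      tendsto_id)).const_mul_atTop (show 0 < c ^ m * c ^ (M * N) by positivity)
    exact h.eventually_ge_atTop _
  filter_upwards [Real.tendsto_log_atTop.eventually hmain,
    Real.tendsto_log_atTop.eventually hlarge, Real.tendsto_log_atTop.eventually hexp,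
    Real.tendsto_log_atTop.eventually_ge_atTop 1, eventually_gt_atTop 0] with ρ h1 h2 h3 hℓ hρ
  set ℓ := Real.log ρ with hℓdef
  have hℓ0 : 0 < ℓ := by linarith
  have hlog : Real.log √(ℓ / ρ) = -((ℓ - Real.log ℓ) / 2) := by
    rw [Real.log_sqrt (by positivity), Real.log_div hℓ0.ne' hρ.ne']
    ring
  have hterm (i j) : c * Real.exp (C * ℓ - (ℓ + A) ^ 2 / (8 * σ i j ^ 2)) ≤
      gaussianQ ((μ i j - Real.log √(ℓ / ρ)) / σ i j) := by
    have hs := hσ i j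
    rw [hlog]
    refine le_trans ?_ (gaussianQ_ge (div_nonneg ?_ hs.le))
    · refine mul_le_mul_of_nonneg_left (Real.exp_le_exp.2 ?_) hc.le
      have h4 := div_le_div_of_nonneg_right (h1 i j) (c := 8 * σ i j ^ 2) (by positivity)
      rw [add_div, mul_assoc (8 * σ i j ^ 2), mul_div_cancel_left₀ _ (by positivity)] at h4
      have h5 : ((μ i j - -((ℓ - Real.log ℓ) / 2)) / σ i j + 1) ^ 2 / 2
          = (ℓ - Real.log ℓ + (2 * μ i j + 2 * σ i j)) ^ 2 / (8 * σ i j ^ 2) := by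
        field_simp
        ring
      rw [h5]
      linarith
    · have := h2 i j
      linarith
  have hQ : c * Real.exp (-((K ^ 2 + 1) * ℓ) - 1) ≤ gaussianQ (K * √ℓ) := by
    refine le_trans ?_ (gaussianQ_ge (by positivity))
    refine mul_le_mul_of_nonneg_left (Real.exp_le_exp.2 ?_) hc.le
    have hsq : √ℓ ^ 2 = ℓ := Real.sq_sqrt hℓ0.le
    have : (K * √ℓ + 1) ^ 2 ≤ 2 * (K ^ 2 * ℓ) + 2 := by
      nlinarith [sq_nonneg (K * √ℓ - 1)]
    nlinarith
  have hprod : ∏ i : Fin M, ∏ j : Fin N, c * Real.exp (C * ℓ - (ℓ + A) ^ 2 / (8 * σ i j ^ 2)) ≤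
      ∏ i, ∏ j, gaussianQ ((μ i j - Real.log √(ℓ / ρ)) / σ i j) :=
    Finset.prod_le_prod (fun i _ => Finset.prod_nonneg fun j _ => by positivity) fun i _ =>
      Finset.prod_le_prod (fun j _ => by positivity) fun j _ => hterm i j
  refine le_trans ?_ (mul_le_mul (pow_le_pow_left₀ (by positivity) hQ m) hprod
    (Finset.prod_nonneg fun i _ => Finset.prod_nonneg fun j _ => by positivity)
    (pow_nonneg (gaussianQ_nonneg _) _))
  set S := ∑ i, ∑ j, (ℓ + A) ^ 2 / (8 * σ i j ^ 2) with hS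
  have hprod' : ∏ i : Fin M, ∏ j : Fin N, c * Real.exp (C * ℓ - (ℓ + A) ^ 2 / (8 * σ i j ^ 2))
      = c ^ (M * N) * Real.exp (M * N * (C * ℓ) - S) := by
    simp_rw [Finset.prod_mul_distrib, ← Real.exp_sum]
    simp [Finset.sum_sub_distrib, S, pow_mul', mul_assoc]
  have hlow : lowerBound σ Pop e ρ = constL σ e * (ℓ ^ (M * N))⁻¹ * Real.exp (-S) := by
    simp only [lowerBound, hS, A, ← hℓdef, add_sub_assoc]
  have hL : 0 ≤ constL σ e := by
    have : 0 ≤ ∏ i, ∏ j, σ i j :=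
      Finset.prod_nonneg fun i _ => Finset.prod_nonneg fun j _ => (hσ i j).le
    have := gaussianQ_nonneg (1 / 2 * (√(∑ k, e k ^ 2))⁻¹)
    unfold constL
    positivity
  have hMN : (1 : ℝ) ≤ M * N := by exact_mod_cast Nat.mul_pos hM hN
  rw [hprod', hlow, mul_pow, ← Real.exp_nat_mul]
  have h6 : constL σ e * (ℓ ^ (M * N))⁻¹ ≤ constL σ e :=
    mul_le_of_le_one_right hL (inv_le_one_of_one_le₀ (one_le_pow₀ hℓ))
  calc constL σ e * (ℓ ^ (M * N))⁻¹ * Real.exp (-S)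
      ≤ c ^ m * c ^ (M * N) * Real.exp (ℓ - m) * Real.exp (-S) := by
        exact mul_le_mul_of_nonneg_right (h6.trans h3) (Real.exp_pos _).le
    _ = c ^ m * c ^ (M * N) * Real.exp (ℓ - m - S) := by
        rw [mul_assoc _ (Real.exp _), ← Real.exp_add, ← sub_eq_add_neg]
    _ ≤ c ^ m * c ^ (M * N) *
          Real.exp (m * (-((K ^ 2 + 1) * ℓ) - 1) + (M * N * (C * ℓ) - S)) := by
        gcongr
        have : C * ℓ ≤ M * N * (C * ℓ) := le_mul_of_one_le_left (by positivity) hMN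
        have h8 : C * ℓ = m * ((K ^ 2 + 1) * ℓ) + ℓ := by rw [hC]; ring
        linarith
    _ = _ := by rw [Real.exp_add]; ring

/-! ### Averaged pairwise error probability -/

lemma sum_sq_le_sq_sum_of_isUnipolar {N : ℕ} {e h : Fin N → ℝ} (he : IsUnipolar e)
    (hh : ∀ j, 0 < h j) : ∑ j, e j ^ 2 * h j ^ 2 ≤ (∑ j, h j * e j) ^ 2 := by
  rcases he with he | he
  · have := Finset.sum_sq_le_sq_sum_of_nonneg (s := Finset.univ) (f := fun j => h j * e j)
      fun j _ => mul_nonneg (hh j).le (he j)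
    simpa only [mul_pow, mul_comm] using this
  · have := Finset.sum_sq_le_sq_sum_of_nonneg (s := Finset.univ) (f := fun j => h j * -e j)
      fun j _ => mul_nonneg (hh j).le (neg_nonneg.2 (he j))
    simpa only [mul_neg, Finset.sum_neg_distrib, neg_sq, mul_pow, mul_comm] using this

lemma abs_sum_le_of_mem_channelBox {M N : ℕ} {t : ℝ} {H : Fin M → Fin N → ℝ}
    (hH : H ∈ channelBox M N t) (e : Fin N → ℝ) (i : Fin M) :
    |∑ j, H i j * e j| ≤ t * ∑ j, |e j| := by
  rw [Finset.mul_sum]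
  refine (Finset.abs_sum_le_sum_abs _ _).trans (Finset.sum_le_sum fun j _ => ?_)
  have h := hH i trivial j trivial
  rw [abs_mul, abs_of_pos h.1]
  exact mul_le_mul_of_nonneg_right h.2 (abs_nonneg _)

lemma measurable_distance {M N : ℕ} (Pop ρ : ℝ) (e : Fin N → ℝ) :
    Measurable (distance (M := M) Pop ρ e) := by
  unfold distance
  fun_prop

lemma integrable_gaussianQ_distance {M N : ℕ} (μ σ : Fin M → Fin N → ℝ) (Pop ρ : ℝ)
    (e : Fin N → ℝ) :
    Integrable (fun H => gaussianQ (distance Pop ρ e H / 2)) (channelLaw μ σ) := by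
  refine Integrable.of_bound (C := 1) ?_ (Eventually.of_forall fun H => ?_)
  · exact (gaussianQ_antitone.measurable.comp
      ((measurable_distance Pop ρ e).div_const 2)).aestronglyMeasurable
  · rw [Real.norm_of_nonneg (gaussianQ_nonneg _)]
    exact gaussianQ_le_one _

lemma integrable_exp_neg_sum {M N : ℕ} (μ σ : Fin M → Fin N → ℝ) {κ : Fin N → ℝ}
    (hκ : ∀ j, 0 ≤ κ j) :
    Integrable (fun H => Real.exp (-∑ i, ∑ j, κ j * H i j ^ 2)) (channelLaw μ σ) := by
  refine Integrable.of_bound (C := 1) ?_ (Eventually.of_forall fun H => ?_)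
  · exact (by fun_prop : Measurable _).aestronglyMeasurable
  · rw [Real.norm_of_nonneg (Real.exp_pos _).le]
    exact Real.exp_le_one_iff.2 (neg_nonpos.2 (Finset.sum_nonneg fun i _ =>
      Finset.sum_nonneg fun j _ => mul_nonneg (hκ j) (sq_nonneg _)))

lemma pep_le_integral {M N : ℕ} (μ σ : Fin M → Fin N → ℝ) (Pop : ℝ) {e : Fin N → ℝ}
    (he : IsUnipolar e) {ρ : ℝ} (hρ : 0 < ρ) :
    pep μ σ Pop e ρ ≤ ∫ H, Real.exp (-∑ i, ∑ j, 1 / (8 * N * Pop ^ 2) * ρ * e j ^ 2 * H i j ^ 2)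
      ∂channelLaw μ σ := by
  refine integral_mono_of_nonneg (Eventually.of_forall fun H => gaussianQ_nonneg _)
    (integrable_exp_neg_sum μ σ (κ := fun j => 1 / (8 * N * Pop ^ 2) * ρ * e j ^ 2)
      fun j => by positivity) ?_
  filter_upwards [ae_channelLaw_pos μ σ] with H hH
  refine (gaussianQ_le_exp (by unfold distance; positivity)).trans (Real.exp_le_exp.2 ?_)
  rw [distance, div_pow, Real.sq_sqrt (by positivity)]
  have h1 : ∑ i, ∑ j, e j ^ 2 * H i j ^ 2 ≤ ∑ i, (∑ j, H i j * e j) ^ 2 :=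
    Finset.sum_le_sum fun i _ => sum_sq_le_sq_sum_of_isUnipolar he (hH i)
  have h2 : ∑ i, ∑ j, 1 / (8 * N * Pop ^ 2) * ρ * e j ^ 2 * H i j ^ 2
      = ρ / (N * Pop ^ 2) * (∑ i, ∑ j, e j ^ 2 * H i j ^ 2) / 2 ^ 2 / 2 := by
    simp only [Finset.mul_sum, Finset.sum_div]
    refine Finset.sum_congr rfl fun i _ => Finset.sum_congr rfl fun j _ => ?_
    ring
  rw [h2]
  gcongr

/-- Restrict the average to the box, where the distance is at most its value with every row sum
replaced by `t * ∑ j, |e j|`. -/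
lemma mul_channelLaw_le_pep {M N : ℕ} (μ σ : Fin M → Fin N → ℝ) (Pop : ℝ) (e : Fin N → ℝ)
    {ρ : ℝ} (hρ : 0 < ρ) (t : ℝ) :
    gaussianQ (√(ρ / (N * Pop ^ 2) * ∑ _i : Fin M, (t * ∑ j, |e j|) ^ 2) / 2) *
      (channelLaw μ σ).real (channelBox M N t) ≤ pep μ σ Pop e ρ := by
  rw [mul_comm, ← smul_eq_mul, ← integral_indicator_const _ (measurableSet_channelBox M N t)]
  refine integral_mono_of_nonneg (Eventually.of_forall fun H =>
    Set.indicator_nonneg (fun _ _ => gaussianQ_nonneg _) _)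
    (integrable_gaussianQ_distance μ σ Pop ρ e) (Eventually.of_forall fun H => ?_)
  refine Set.indicator_apply_le' (fun hH => gaussianQ_antitone ?_) fun _ => gaussianQ_nonneg _
  unfold distance
  gcongr √(ρ / (N * Pop ^ 2) * ∑ i, ?_) / 2 with i
  exact sq_le_sq' (by linarith [neg_abs_le (∑ j, H i j * e j),
    abs_sum_le_of_mem_channelBox hH e i])
    ((le_abs_self _).trans (abs_sum_le_of_mem_channelBox hH e i))

/-! ### Maximum-likelihood error probability -/

lemma likelihood_le_iff {M N : ℕ} {Pop : ℝ} {v : ℝ≥0} (hv : v ≠ 0) (H : Fin M → Fin N → ℝ)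
    (x x' : Fin N → ℝ) (n : Fin M → ℝ) :
    likelihood Pop v H (received Pop H x n) x ≤ likelihood Pop v H (received Pop H x n) x' ↔
      ∑ i, n i * (1 / Pop * ∑ j, H i j * (x - x') j) ≤
        -((∑ i, (1 / Pop * ∑ j, H i j * (x - x') j) ^ 2) / 2) := by
  have hv' : (0 : ℝ) < v := by exact_mod_cast pos_iff_ne_zero.2 hv
  unfold likelihood received gaussianPDFReal
  simp_rw [Finset.prod_mul_distrib, ← Real.exp_sum]
  rw [mul_le_mul_iff_right₀ (Finset.prod_pos fun i _ => by positivity), Real.exp_le_exp,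
    ← Finset.sum_div, ← Finset.sum_div, div_le_div_iff_of_pos_right (by positivity)]
  have h1 (i : Fin M) : -(1 / Pop * ∑ j, H i j * x j + n i - 1 / Pop * ∑ j, H i j * x' j) ^ 2
      = -(1 / Pop * ∑ j, H i j * x j + n i - 1 / Pop * ∑ j, H i j * x j) ^ 2
        - 2 * (n i * (1 / Pop * ∑ j, H i j * (x - x') j))
        - (1 / Pop * ∑ j, H i j * (x - x') j) ^ 2 := by
    simp only [Pi.sub_apply, mul_sub, Finset.sum_sub_distrib]
    ring
  simp_rw [h1, Finset.sum_sub_distrib, ← Finset.mul_sum]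
  constructor <;> intro h <;> linarith

/-- The Chernoff bound for a linear functional of white Gaussian noise. -/
lemma pi_gaussianReal_real_le {M : ℕ} {v : ℝ≥0} (hv : v ≠ 0) (δ : Fin M → ℝ) :
    (Measure.pi fun _ : Fin M => gaussianReal 0 v).real
      {n | ∑ i, n i * δ i ≤ -((∑ i, δ i ^ 2) / 2)} ≤ Real.exp (-((∑ i, δ i ^ 2) / (8 * v))) := by
  have hv' : (0 : ℝ) < v := by exact_mod_cast pos_iff_ne_zero.2 hv
  -- With D = ∑ δ_i², this minimizes the Chernoff exponent tD/2 + vt²D/2.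
  set t : ℝ := -(1 / (2 * v))
  have hexp (n : Fin M → ℝ) : Real.exp (t * ∑ i, n i * δ i)
      = ∏ i, Real.exp (t * δ i * n i) := by
    rw [← Real.exp_sum, Finset.mul_sum]
    congr 1
    exact Finset.sum_congr rfl fun i _ => by ring
  have hint : Integrable (fun n : Fin M → ℝ => Real.exp (t * ∑ i, n i * δ i))
      (Measure.pi fun _ : Fin M => gaussianReal 0 v) := by
    simp_rw [hexp]
    exact Integrable.fintype_prod (f := fun i x => Real.exp (t * δ i * x))
      fun i => integrable_exp_mul_gaussianReal (t * δ i)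
  refine (measure_le_le_exp_mul_mgf (X := fun n : Fin M → ℝ => ∑ i, n i * δ i)
    (-((∑ i, δ i ^ 2) / 2)) (t := t) (by simp only [t]; rw [neg_nonpos]; positivity)
    hint).trans_eq ?_
  have hmgf : mgf (fun n : Fin M → ℝ => ∑ i, n i * δ i)
      (Measure.pi fun _ : Fin M => gaussianReal 0 v) t
      = Real.exp (∑ i, v * (t * δ i) ^ 2 / 2) := by
    simp_rw [mgf, hexp]
    rw [integral_fintype_prod_eq_prod (f := fun i x => Real.exp (t * δ i * x)), Real.exp_sum]
    refine Finset.prod_congr rfl fun i _ => ?_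
    have := congrFun (mgf_id_gaussianReal (μ := 0) (v := v)) (t * δ i)
    simpa [mgf] using this
  rw [hmgf, ← Real.exp_add]
  congr 1
  have : ∑ i, v * (t * δ i) ^ 2 / 2 = v * t ^ 2 / 2 * ∑ i, δ i ^ 2 := by
    rw [Finset.mul_sum]
    exact Finset.sum_congr rfl fun i _ => by ring
  rw [this]
  simp only [t]
  field_simp
  ring

lemma mlPairwiseError_le_integral {M N : ℕ} (μ σ : Fin M → Fin N → ℝ) (Pop : ℝ)
    {x x' : Fin N → ℝ} (he : IsUnipolar (x - x')) {v : ℝ≥0} (hv : v ≠ 0) :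
    mlPairwiseError μ σ Pop x x' v ≤
      ∫ H, Real.exp (-∑ i, ∑ j, 1 / (8 * Pop ^ 2 * v) * (x - x') j ^ 2 * H i j ^ 2)
        ∂channelLaw μ σ := by
  have hv' : (0 : ℝ) < v := by exact_mod_cast pos_iff_ne_zero.2 hv
  unfold mlPairwiseError
  simp_rw [likelihood_le_iff hv]
  have hS : MeasurableSet {w : (Fin M → Fin N → ℝ) × (Fin M → ℝ) |
      ∑ i, w.2 i * (1 / Pop * ∑ j, w.1 i j * (x - x') j) ≤
        -((∑ i, (1 / Pop * ∑ j, w.1 i j * (x - x') j) ^ 2) / 2)} :=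
    measurableSet_le (by fun_prop) (by fun_prop)
  have hint := integrable_exp_neg_sum μ σ
    (κ := fun j => 1 / (8 * Pop ^ 2 * v) * (x - x') j ^ 2) fun j => by positivity
  rw [measureReal_def, Measure.prod_apply hS]
  refine ENNReal.toReal_le_of_le_ofReal (integral_nonneg fun H => (Real.exp_pos _).le) ?_
  rw [ofReal_integral_eq_lintegral_ofReal hint
    (Eventually.of_forall fun H => (Real.exp_pos _).le)]
  refine lintegral_mono_ae ?_
  filter_upwards [ae_channelLaw_pos μ σ] with H hH
  rw [← ENNReal.ofReal_toReal (measure_ne_top _ _)]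
  refine ENNReal.ofReal_le_ofReal ((pi_gaussianReal_real_le hv
    (fun i => 1 / Pop * ∑ j, H i j * (x - x') j)).trans (Real.exp_le_exp.2 ?_))
  have h1 : ∑ i, ∑ j, (x - x') j ^ 2 * H i j ^ 2 ≤ ∑ i, (∑ j, H i j * (x - x') j) ^ 2 :=
    Finset.sum_le_sum fun i _ => sum_sq_le_sq_sum_of_isUnipolar he (hH i)
  have h2 := mul_le_mul_of_nonneg_left h1 (show 0 ≤ 1 / (8 * Pop ^ 2 * v) by positivity)
  refine neg_le_neg (le_of_eq_of_le ?_ (h2.trans_eq ?_))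
  · simp only [Finset.mul_sum]
    refine Finset.sum_congr rfl fun i _ => Finset.sum_congr rfl fun j _ => ?_
    ring
  · simp only [mul_pow, ← Finset.mul_sum]
    field_simp

/-- An error is certain if every noise component opposes its signal difference δ_i and is at least
as large: then n_i δ_i ≤ -δ_i² ≤ -δ_i²/2. Unipolarity gives all δ_i one sign, independent of `H`, so
the error event contains a product of a channel box and a noise orthant. -/
lemma mul_channelLaw_le_mlPairwiseError {M N : ℕ} (μ σ : Fin M → Fin N → ℝ) {Pop : ℝ}
    (hPop : 0 < Pop) {x x' : Fin N → ℝ} (he : IsUnipolar (x - x')) {s t : ℝ} (hs : 0 < s) :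
    gaussianQ (1 / Pop * (t * ∑ j, |(x - x') j|) / s) ^ M *
      (channelLaw μ σ).real (channelBox M N t) ≤
        mlPairwiseError μ σ Pop x x' (s ^ 2).toNNReal := by
  have hv : (s ^ 2).toNNReal ≠ 0 := (Real.toNNReal_pos.2 (by positivity)).ne'
  obtain ⟨ε, hε, hsgn⟩ : ∃ ε : ℝ, ε ^ 2 = 1 ∧ ∀ j, 0 ≤ ε * (x - x') j := by
    rcases he with he | he
    · exact ⟨1, by norm_num, fun j => by simpa using he j⟩
    · exact ⟨-1, by norm_num, fun j => by linarith [he j]⟩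
  set b := 1 / Pop * (t * ∑ j, |(x - x') j|)
  set T : Set (Fin M → ℝ) := Set.pi Set.univ fun _ => {y | ε * (y - 0) ≤ -b}
  have hT : gaussianQ (b / s) ^ M ≤
      (Measure.pi fun _ : Fin M => gaussianReal 0 (s ^ 2).toNNReal).real T := by
    have h1 : (Measure.pi fun _ : Fin M => gaussianReal 0 (s ^ 2).toNNReal).real T
        = (gaussianReal 0 (s ^ 2).toNNReal).real {y | ε * (y - 0) ≤ -b} ^ M := by
      simp [measureReal_def, T, Measure.pi_pi]
    rw [h1]
    exact pow_le_pow_left₀ (gaussianQ_nonneg _) (gaussianQ_le_gaussianReal hs hε) M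
  refine (mul_le_mul_of_nonneg_right hT measureReal_nonneg).trans ?_
  rw [mul_comm, ← measureReal_prod_prod]
  refine measureReal_mono ?_
  rintro ⟨H, n⟩ ⟨hH, hn⟩
  refine (likelihood_le_iff hv H x x' n).2 ?_
  rw [Finset.sum_div, ← Finset.sum_neg_distrib]
  refine Finset.sum_le_sum fun i _ => ?_
  set δ := 1 / Pop * ∑ j, H i j * (x - x') j
  have hδ : 0 ≤ ε * δ := by
    have : ε * δ = 1 / Pop * ∑ j, H i j * (ε * (x - x') j) := by
      simp only [δ, Finset.mul_sum]
      exact Finset.sum_congr rfl fun j _ => by ring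
    rw [this]
    exact mul_nonneg (by positivity) (Finset.sum_nonneg fun j _ =>
      mul_nonneg (hH i trivial j trivial).1.le (hsgn j))
  have hδb : ε * δ ≤ b := by
    refine (le_abs_self _).trans ?_
    rw [abs_mul, (pow_eq_one_iff_of_nonneg (abs_nonneg ε) two_ne_zero).1
      ((sq_abs ε).trans hε), one_mul, abs_mul,
      abs_of_pos (by positivity : 0 < 1 / Pop)]
    exact mul_le_mul_of_nonneg_left (abs_sum_le_of_mem_channelBox hH _ i) (by positivity)
  have hni : ε * n i ≤ -b := by simpa using hn i trivial
  have h2 : n i * δ = ε * n i * (ε * δ) := by linear_combination (-(n i * δ)) * hε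
  have h3 : δ ^ 2 = (ε * δ) ^ 2 := by rw [mul_pow ε, hε, one_mul]
  rw [h2, h3]
  nlinarith

end MimoOwc

theorem theorem1 {L M N : ℕ} (hM : 0 < M)
    (B : Finset ℝ) (F : Fin L → ℝ → Fin N → ℝ)
    (μ σ : Fin M → Fin N → ℝ) (hσ : ∀ i j, 0 < σ i j)
    (hP : 0 < MimoOwc.averagePower B F)
    (hE : ∀ e ∈ MimoOwc.errorSet B F, MimoOwc.IsUnipolar e ∧ ∀ j, e j ≠ 0)
    (s s' : Fin L → ℝ)
    (hs : s ∈ MimoOwc.symbolVectors L B) (hs' : s' ∈ MimoOwc.symbolVectors L B)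
    (hss' : MimoOwc.codeword F s ≠ MimoOwc.codeword F s')
    (Pop : ℝ) (hPop : Pop = MimoOwc.averagePower B F)
    (e : Fin N → ℝ) (he : e = MimoOwc.codeword F s - MimoOwc.codeword F s') :
    MimoOwc.AsymptoticallyBounded
      (MimoOwc.lowerBound σ Pop e)
      (MimoOwc.pep μ σ Pop e)
      (MimoOwc.upperBound σ Pop e)
      (MimoOwc.remainder σ) ∧
    MimoOwc.AsymptoticallyBounded
      (MimoOwc.lowerBound σ Pop e)
      (fun ρ => MimoOwc.mlPairwiseError μ σ Pop (MimoOwc.codeword F s) (MimoOwc.codeword F s')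
        (Real.toNNReal (1 / (N * ρ))))
      (MimoOwc.upperBound σ Pop e)
      (MimoOwc.remainder σ) := by
  obtain ⟨huni, hne⟩ := hE e ⟨s, hs, s', hs', hss', he⟩
  have hPop0 : 0 < Pop := hPop ▸ hP
  have hN : 0 < N := by
    rcases Nat.eq_zero_or_pos N with rfl | h
    · exact absurd (Subsingleton.elim _ _) hss'
    · exact h
  have hN' : (0 : ℝ) < N := by exact_mod_cast hN
  set E := ∑ j, |e j| with hEdef
  have hE0 : 0 ≤ E := Finset.sum_nonneg fun j _ => abs_nonneg _
  -- The remainder is taken to be zero in both upper bounds.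
  refine ⟨⟨?_, 0, isBigO_zero _ _, ?_⟩, ⟨?_, 0, isBigO_zero _ _, ?_⟩⟩
  · filter_upwards [MimoOwc.eventually_lowerBound_le_prod hM hN μ hσ Pop e
      -- At fade level √(ℓ/ρ) the factor ρ cancels in the distance, leaving this constant times √ℓ.
      (K := √(1 / (N * Pop ^ 2) * (M * E ^ 2)) / 2) (by positivity) 1,
      Real.tendsto_log_atTop.eventually_gt_atTop 0, eventually_gt_atTop 0] with ρ h hℓ hρ
    have ht : 0 < √(Real.log ρ / ρ) := by positivity
    refine h.trans (le_trans ?_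
      (MimoOwc.mul_channelLaw_le_pep μ σ Pop e hρ √(Real.log ρ / ρ)))
    have h1 : √(ρ / (N * Pop ^ 2) * ∑ _i : Fin M, (√(Real.log ρ / ρ) * E) ^ 2) / 2
        = √(1 / (N * Pop ^ 2) * (M * E ^ 2)) / 2 * √(Real.log ρ) := by
      rw [div_mul_eq_mul_div _ _ √(Real.log ρ), ← Real.sqrt_mul (by positivity)]
      simp only [mul_pow, Real.sq_sqrt (div_nonneg hℓ.le hρ.le), Finset.sum_const,
        Finset.card_univ, Fintype.card_fin, nsmul_eq_mul]
      congr 2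
      field_simp
    rw [h1, pow_one]
    exact mul_le_mul_of_nonneg_left (MimoOwc.prod_gaussianQ_le_channelLaw μ hσ ht)
      (MimoOwc.gaussianQ_nonneg _)
  · filter_upwards [MimoOwc.eventually_integral_le_upperBound hM hN μ hσ hPop0 hne
      (k := 1 / (8 * N * Pop ^ 2)) (by positivity), eventually_gt_atTop 0] with ρ h hρ
    simpa using (MimoOwc.pep_le_integral μ σ Pop huni hρ).trans h
  · filter_upwards [MimoOwc.eventually_lowerBound_le_prod hM hN μ hσ Pop e
      (K := 1 / Pop * E * √N) (by positivity) M,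
      Real.tendsto_log_atTop.eventually_gt_atTop 0, eventually_gt_atTop 0] with ρ h hℓ hρ
    have ht : 0 < √(Real.log ρ / ρ) := by positivity
    have h2 := MimoOwc.mul_channelLaw_le_mlPairwiseError μ σ hPop0 (he ▸ huni)
      (s := √(1 / (N * ρ))) (t := √(Real.log ρ / ρ)) (by positivity)
    rw [Real.sq_sqrt (by positivity), ← he, ← hEdef] at h2
    refine h.trans (le_trans ?_ h2)
    have h1 : 1 / Pop * (√(Real.log ρ / ρ) * E) / √(1 / (N * ρ))
        = 1 / Pop * E * √N * √(Real.log ρ) := by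
      rw [Real.sqrt_div hℓ.le, Real.sqrt_div zero_le_one, Real.sqrt_mul hN'.le, Real.sqrt_one]
      field_simp
    rw [h1]
    exact mul_le_mul_of_nonneg_left (MimoOwc.prod_gaussianQ_le_channelLaw μ hσ ht)
      (pow_nonneg (MimoOwc.gaussianQ_nonneg _) _)
  -- Noise of variance 1/(Nρ) gives a factor N where `distance` has 1/N. The discrepancy is
  -- harmless, since the comparison holds for every positive `k`.
  · filter_upwards [MimoOwc.eventually_integral_le_upperBound hM hN μ hσ hPop0 hne
      (k := N / (8 * Pop ^ 2)) (by positivity), eventually_gt_atTop 0] with ρ h hρ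
    have hv : (1 / (N * ρ)).toNNReal ≠ 0 := (Real.toNNReal_pos.2 (by positivity)).ne'
    have h2 := MimoOwc.mlPairwiseError_le_integral μ σ Pop (he ▸ huni) hv
    rw [Real.coe_toNNReal _ (by positivity), ← he] at h2
    have h3 : 1 / (8 * Pop ^ 2 * (1 / (N * ρ))) = N / (8 * Pop ^ 2) * ρ := by
      field_simp
    rw [h3] at h2
    simpa using h2.trans h
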